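/- Let $k\in\{0,1,-1\}$ and $f_0>0$ with $1+k/f_0>0$, and put $m=\sqrt{1+k/f_0}>0$. Units are such that $8\pi G=c=1$; the cosmological constant is zero. A metric $ds^2=-d\tau^2+\omega(\tau,r)^2dr^2+\varphi(\tau)C^2(dx^2+dy^2)$ with $C=[1+\tfrac k4(x^2+y^2)]^{-1}$ is a \emph{T-model} if it is a perfect fluid solution of the Einstein equations, $G_{ab}=(\rho+p)u_au_b+p\,g_{ab}$, with comoving velocity $u=\partial_\tau$. The \emph{indicatrix} is $\chi=u(p)/u(\rho)$ (where $u(\rho)\ne0$). The \emph{energy conditions} are $-\rho<p\le\rho$. The \emph{compressibility conditions} $H_1$ for a function of state $\chi(\rho,p)$ are $0<\chi<1$ and $(\rho+p)(\chi\chi'_p+\chi'_\rho)+2\chi(1-\chi)>0$; for $\chi=\chi(\pi)$, $\pi=p/\rho$, they take the form $0<\chi<1$ and $(1+\pi)(\chi-\pi)\chi'+2\chi(1-\chi)>0$. Take $\varphi=f_0\tau^2$. (1) Let $I\not\ni0$ be an open interval, $J\subset\mathbb R$ open, and $\omega$ a nowhere vanishing $C^2$ function on $I\times J$. The metric, on the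 events with $\tau\in I$, $r\in J$, $1+\tfrac k4(x^2+y^2)\neq0$, is a T-model if and only if $\omega=\omega_1(\tau)Q_1(r)+\omega_2(\tau)Q_2(r)$ for some functions $Q_1,Q_2$, where $\omega_1=|\tau|^m$ and $\omega_2=|\tau|^{-m}$ (that is, $\tau^m$ and $\tau^{-m}$ when $\tau>0$); and $\omega_1,\omega_2$ are linearly independent. (2) Let $\omega=\omega_1+\omega_2\,Q(r)$ with $Q$ of class $C^2$ on an open set $J$ (the generalised McVittie–Wiltshire–Herlt models), and consider the events with $\tau\ne0$, $r\in J$, $1+\tfrac k4(x^2+y^2)\neq0$ and $\omega\ne0$. Functions $\rho,p$ are the energy density and pressure of this solution if and only if $$p=-\frac{m^2}{\tau^2},\qquad \rho=\frac{m^2}{\tau^2}\Big[1+\frac2m\,\frac{|\tau|^{2m}-Q(r)}{|\tau|^{2m}+Q(r)}\Big].$$ In particular $p<0$. The energy conditions hold at an event if and only if $|Q(r)|<|\tau|^{2m}$. (3) At every such event with $\rho\ne0$ and $u(\rho)\neq0$, the denominator below is non-zero and the indicatrix is of ideal type, a function of $\pi=p/\rho$ alone: $$\chi=\frac{4\pi^2}{(\pi+1)\,[(4-m^2)\pi-m^2]}.$$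 (4) At every event where the energy conditions hold one has $\rho>0$ and $u(\rho)\ne0$, and the compressibility conditions $H_1$ (in either form) fail there, whatever function of state represents the indicatrix. If $k\ne-1$, they fail at every event with $u(\rho)\neq0$, whether or not the energy conditions hold there. Consequently these solutions cannot model a perfect fluid in local thermal equilibrium: there is no non-empty region on which the energy conditions hold and $u(p)=\chi(\rho,p)\,u(\rho)$ for a function of state $\chi$ that satisfies $H_1$. -/

import Mathlib

noncomputable section

namespace TModels

/-- Coordinates of an event, in the order `(τ, r, x, y)`. -/
abbrev Coord : Type := Fin 4 → ℝ

/-- The components `g_ab` of a metric tensor in the coordinates. -/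
abbrev MetricField : Type := Coord → Matrix (Fin 4) (Fin 4) ℝ

/-- The partial derivative `∂_a f` at `x`. -/
def partialD (a : Fin 4) (f : Coord → ℝ) (x : Coord) : ℝ :=
  deriv (fun t => f (Function.update x a t)) (x a)

/-- The Christoffel symbol `Γ^a_bc` of the Levi-Civita connection of `g`. -/
def christoffel (g : MetricField) (a b c : Fin 4) (x : Coord) : ℝ :=
  (1 / 2) * ∑ d, (g x)⁻¹ a d *
    (partialD b (fun y => g y d c) x + partialD c (fun y => g y d b) x
      - partialD d (fun y => g y b c) x)

/-- The Ricci tensor `R_bc = ∂_a Γ^a_bc - ∂_c Γ^a_ba + Γ^a_ad Γ^d_bc - Γ^a_cd Γ^d_ba`. -/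
def ricci (g : MetricField) (b c : Fin 4) (x : Coord) : ℝ :=
  ∑ a, (partialD a (christoffel g a b c) x - partialD c (christoffel g a b a) x
    + ∑ d, (christoffel g a a d x * christoffel g d b c x
      - christoffel g a c d x * christoffel g d b a x))

/-- The scalar curvature `g^bc R_bc`. -/
def scalarCurvature (g : MetricField) (x : Coord) : ℝ :=
  ∑ b, ∑ c, (g x)⁻¹ b c * ricci g b c x

/-- The Einstein tensor `G_ab = R_ab - (1/2) R g_ab`. -/
def einstein (g : MetricField) (a b : Fin 4) (x : Coord) : ℝ :=
  ricci g a b x - (1 / 2) * scalarCurvature g x * g x a b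

/-- The covariant components `u_a = g_ab u^b` of a vector field `u`. -/
def lower (g : MetricField) (u : Coord → Fin 4 → ℝ) (a : Fin 4) (x : Coord) : ℝ :=
  ∑ b, g x a b * u x b

/-- The derivative `u(q) = u^a ∂_a q` of a scalar `q` along a vector field `u`. -/
def along (u : Coord → Fin 4 → ℝ) (q : Coord → ℝ) (x : Coord) : ℝ :=
  ∑ a, u x a * partialD a q x

/-- On the region `D`, the metric `g` (signature `-+++`, units `8πG = c = 1`) solves the Einstein
equations `G = T` for the perfect fluid `T = (ρ + p) u ⊗ u + p g` with unit velocity `u`,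
energy density `ρ` and pressure `p`. -/
def IsPerfectFluidSolution (g : MetricField) (u : Coord → Fin 4 → ℝ) (ρ p : Coord → ℝ)
    (D : Set Coord) : Prop :=
  ∀ x ∈ D, ∑ a, lower g u a x * u x a = -1 ∧
    ∀ a b, einstein g a b x = (ρ x + p x) * lower g u a x * lower g u b x + p x * g x a b

/-- `1 + (k/4)(x² + y²)`, the reciprocal of the conformal factor `C` of the 2-surfaces of
constant curvature. -/
def conf (k : ℝ) (x : Coord) : ℝ := 1 + k / 4 * (x 2 ^ 2 + x 3 ^ 2)

/-- The metric `ds² = -dτ² + ω(τ,r)² dr² + φ(τ) C² (dx² + dy²)` with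
`C = [1 + (k/4)(x² + y²)]⁻¹`; here `τ` is the proper time of the comoving observers. -/
def tMetric (k : ℝ) (φ : ℝ → ℝ) (ω : ℝ → ℝ → ℝ) : MetricField := fun x =>
  Matrix.diagonal ![-1, ω (x 0) (x 1) ^ 2, φ (x 0) * ((conf k x)⁻¹) ^ 2,
    φ (x 0) * ((conf k x)⁻¹) ^ 2]

/-- The comoving velocity `u = ∂_τ`. -/
def comoving : Coord → Fin 4 → ℝ := fun _ => Pi.single 0 1

/-- The energy conditions for a perfect fluid, `-ρ < p ≤ ρ`. -/
def EnergyConditions (ρ p : ℝ) : Prop := -ρ < p ∧ p ≤ ρ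

/-- The indicatrix `u(p) / u(ρ)` (meaningful where `u(ρ) ≠ 0`). -/
def indicatrix (u : Coord → Fin 4 → ℝ) (ρ p : Coord → ℝ) (x : Coord) : ℝ :=
  along u p x / along u ρ x

/-- The compressibility conditions `H₁` at the state `(ρ, p)` for a function of state
`χ = χ(ρ, p)`: `0 < χ < 1` and `(ρ + p)(χ χ'_p + χ'_ρ) + 2 χ (1 - χ) > 0`. -/
def CompressibilityConditions (χ : ℝ → ℝ → ℝ) (ρ p : ℝ) : Prop :=
  0 < χ ρ p ∧ χ ρ p < 1 ∧
    0 < (ρ + p) * (χ ρ p * deriv (fun p' => χ ρ p') p + deriv (fun ρ' => χ ρ' p) ρ)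
      + 2 * χ ρ p * (1 - χ ρ p)

/-- The form of `H₁` for an ideal-type function of state `χ = χ(π)`, `π = p / ρ`:
`0 < χ < 1` and `(1 + π)(χ - π) χ' + 2 χ (1 - χ) > 0`. -/
def IdealCompressibilityConditions (χ : ℝ → ℝ) (π : ℝ) : Prop :=
  0 < χ π ∧ χ π < 1 ∧
    0 < (1 + π) * (χ π - π) * deriv χ π + 2 * χ π * (1 - χ π)

/-- On the region `U`, the fluid `(u, ρ, p)` meets the hydrodynamic constraints necessary for
modelling a perfect fluid in local thermal equilibrium: the energy conditions, and the existence
of a function of state `χ(ρ, p)` with `u(p) = χ(ρ, p) u(ρ)` (the sonic condition) that satisfies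
the compressibility conditions. -/
def IsAdmissibleOn (u : Coord → Fin 4 → ℝ) (ρ p : Coord → ℝ) (U : Set Coord) : Prop :=
  ∃ χ : ℝ → ℝ → ℝ, ∀ x ∈ U, EnergyConditions (ρ x) (p x) ∧
    along u p x = χ (ρ x) (p x) * along u ρ x ∧
    CompressibilityConditions χ (ρ x) (p x)

/-- The metric function `ω = ω₁ + ω₂ Q(r)` of the generalised McVittie-Wiltshire-Herlt models,
`ω₁ = |τ|^m` and `ω₂ = |τ|^(-m)`. -/
def mwhOmega (m : ℝ) (Q : ℝ → ℝ) : ℝ → ℝ → ℝ := fun τ r => |τ| ^ m + |τ| ^ (-m) * Q r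

/-- The metric of the generalised McVittie-Wiltshire-Herlt models, `φ = f₀ τ²`. -/
def mwhMetric (k f₀ m : ℝ) (Q : ℝ → ℝ) : MetricField :=
  tMetric k (fun τ => f₀ * τ ^ 2) (mwhOmega m Q)

/-- The events with `r ∈ J` where that metric is defined and non-degenerate. -/
def mwhDomain (k m : ℝ) (Q : ℝ → ℝ) (J : Set ℝ) : Set Coord :=
  {x | x 0 ≠ 0 ∧ x 1 ∈ J ∧ conf k x ≠ 0 ∧ mwhOmega m Q (x 0) (x 1) ≠ 0}

/-- The ideal-type function of state `4π² / ((π + 1)[(4 - m²)π - m²])`. -/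
def mwhChi (m : ℝ) : ℝ → ℝ := fun π =>
  4 * π ^ 2 / ((π + 1) * ((4 - m ^ 2) * π - m ^ 2))

end TModels

end

open Filter Topology

noncomputable section

namespace TModels

/-! For `φ = f₀ τ²` the Einstein tensor is diagonal. Its 00 and 11 components determine `ρ` and `p =
-m²/τ²`; the only remaining condition, that the pressure along `x, y` equal the pressure along `r`,
is the Euler equation `τ² ω'' + τ ω' = m² ω` in `τ` alone, with `r` as a parameter. Its solutions
are spanned by `|τ|^m` and `|τ|^(-m)` (`perfectFluid_at_iff`, `euler_equation_solution`).

For `ω = ω₁ + ω₂ Q` everything depends on `s = (ω₁ - ω₂ Q)/(ω₁ + ω₂ Q)`. It satisfies `τ ω' = m s ω`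
and the Riccati equation `τ s' = m (1 - s²)`, so `ρ`, `u(ρ)`, `χ = -m/(s (2 + m s))` and `π = -m/(m
+ 2 s)` are explicit in `s`; eliminating `s` gives the ideal-type indicatrix.

The energy conditions amount to `s > 0`, and then `χ < 0`. If `k ≠ -1` then `m ≥ 1`, and a positive
`χ` is at least `1`. Either way `0 < χ < 1` already fails, whatever the derivatives of `χ` are. -/

/-! ### Coordinate derivatives -/

theorem partialD_congr {f g : Coord → ℝ} {x : Coord} (h : f =ᶠ[𝓝 x] g) (a : Fin 4) :
    partialD a f x = partialD a g x := by
  have hc : Tendsto (fun t => Function.update x a t) (𝓝 (x a)) (𝓝 x) := by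
    have : Continuous fun t => Function.update x a t := by fun_prop
    simpa using this.tendsto (x a)
  exact EventuallyEq.deriv_eq (hc.eventually h)

@[simp]
theorem partialD_const (a : Fin 4) (c : ℝ) (x : Coord) : partialD a (fun _ => c) x = 0 := by
  simp [partialD]

/-- The partial derivative with respect to proper time. -/
def timeD (ω : ℝ → ℝ → ℝ) (τ r : ℝ) : ℝ := deriv (fun t => ω t r) τ

/-- The partial derivative with respect to the radial coordinate. -/
def radialD (ω : ℝ → ℝ → ℝ) (τ r : ℝ) : ℝ := deriv (ω τ) r

/-- The gradient of a function of `τ` and `r`. -/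
def grad (F : ℝ → ℝ → ℝ) (τ r : ℝ) : Fin 4 → ℝ := ![timeD F τ r, radialD F τ r, 0, 0]

theorem partialD_fun_coord (F : ℝ → ℝ → ℝ) (a : Fin 4) (x : Coord) :
    partialD a (fun y => F (y 0) (y 1)) x = grad F (x 0) (x 1) a := by
  fin_cases a <;> simp [partialD, grad, timeD, radialD]

theorem hasDerivAt_conf_two (k : ℝ) (x : Coord) :
    HasDerivAt (fun t => conf k (Function.update x 2 t)) (k / 2 * x 2) (x 2) := by
  have h : (fun t => conf k (Function.update x 2 t))
      = fun t => 1 + k / 4 * (t ^ 2 + x 3 ^ 2) := by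
    funext t; simp [conf]
  rw [h]
  refine (((((hasDerivAt_id' (x 2)).fun_pow 2).add_const (x 3 ^ 2)).const_mul (k / 4)).const_add
    1).congr_deriv ?_
  push_cast; ring

theorem hasDerivAt_conf_three (k : ℝ) (x : Coord) :
    HasDerivAt (fun t => conf k (Function.update x 3 t)) (k / 2 * x 3) (x 3) := by
  have h : (fun t => conf k (Function.update x 3 t))
      = fun t => 1 + k / 4 * (x 2 ^ 2 + t ^ 2) := by
    funext t; simp [conf]
  rw [h]
  refine (((((hasDerivAt_id' (x 3)).fun_pow 2).const_add (x 2 ^ 2)).const_mul (k / 4)).const_add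
    1).congr_deriv ?_
  push_cast; ring

/-- The gradient of the reciprocal conformal factor. -/
def confGrad (k : ℝ) (x : Coord) : Fin 4 → ℝ := ![0, 0, k / 2 * x 2, k / 2 * x 3]

theorem hasDerivAt_conf (k : ℝ) (x : Coord) (a : Fin 4) :
    HasDerivAt (fun t => conf k (Function.update x a t)) (confGrad k x a) (x a) := by
  fin_cases a
  · simpa [conf, confGrad] using hasDerivAt_const (x 0) (conf k x)
  · simpa [conf, confGrad] using hasDerivAt_const (x 1) (conf k x)
  · exact hasDerivAt_conf_two k x
  · exact hasDerivAt_conf_three k x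

theorem hasDerivAt_coord (x : Coord) (a i : Fin 4) :
    HasDerivAt (fun t => Function.update x a t i) ((Pi.single a 1 : Fin 4 → ℝ) i) (x a) := by
  by_cases h : i = a
  · subst h; simpa using hasDerivAt_id' (x i)
  · simpa [h] using hasDerivAt_const (x a) (x i)

theorem partialD_coord_mul_inv_conf {k : ℝ} {x : Coord} (hc : conf k x ≠ 0) (c : ℝ)
    (a i : Fin 4) :
    partialD a (fun y => c * y i * (conf k y)⁻¹) x
      = c * (Pi.single a 1 : Fin 4 → ℝ) i * (conf k x)⁻¹
        - c * x i * confGrad k x a * (conf k x)⁻¹ ^ 2 := by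
  have h := ((hasDerivAt_coord x a i).const_mul c).fun_mul
    ((hasDerivAt_conf k x a).fun_inv (by simpa using hc))
  rw [partialD, h.deriv]
  simp only [Function.update_eq_self]
  field_simp; ring

theorem partialD_coord_mul_inv_conf_sq {k : ℝ} {x : Coord} (hc : conf k x ≠ 0) (c : ℝ)
    (n : ℕ) (a i : Fin 4) :
    partialD a (fun y => c * y i ^ n * (conf k y)⁻¹ ^ 2) x
      = c * (n * x i ^ (n - 1) * (Pi.single a 1 : Fin 4 → ℝ) i) * (conf k x)⁻¹ ^ 2
        - 2 * c * x i ^ n * confGrad k x a * (conf k x)⁻¹ ^ 3 := by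
  have h := (((hasDerivAt_coord x a i).fun_pow n).const_mul c).fun_mul
    (((hasDerivAt_conf k x a).fun_inv (by simpa using hc)).fun_pow 2)
  rw [partialD, h.deriv]
  simp only [Function.update_eq_self]
  push_cast
  simp only [pow_one]
  field_simp
  ring

theorem partialD_inv_coord {x : Coord} (i : Fin 4) (hx : x i ≠ 0) (a : Fin 4) :
    partialD a (fun y => (y i)⁻¹) x = - (Pi.single a 1 : Fin 4 → ℝ) i / x i ^ 2 := by
  have h := (hasDerivAt_coord x a i).fun_inv (by simpa using hx)
  rw [partialD, h.deriv]
  simp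

/-! ### Christoffel symbols -/

/-- The inverse of a diagonal metric is diagonal, so only `d = a` survives in the contraction. -/
theorem christoffel_diagonal {g : MetricField} {h : Coord → Fin 4 → ℝ}
    (hg : ∀ y, g y = Matrix.diagonal (h y)) {x : Coord} (hx : ∀ d, h x d ≠ 0)
    {D : Fin 4 → Fin 4 → ℝ} (hD : ∀ a e, partialD e (fun y => h y a) x = D a e) (a b c : Fin 4) :
    christoffel g a b c x = 1 / 2 * (h x a)⁻¹ *
      ((if a = c then D a b else 0) + (if a = b then D a c else 0)
        - (if b = c then D b a else 0)) := by
  have hinv : (g x)⁻¹ = Matrix.diagonal (fun d => (h x d)⁻¹) := by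
    rw [hg]
    apply Matrix.inv_eq_right_inv
    rw [Matrix.diagonal_mul_diagonal, ← Matrix.diagonal_one]
    congr 1; funext d; exact mul_inv_cancel₀ (hx d)
  have hpd : ∀ e i j, partialD e (fun y => g y i j) x
      = if i = j then D i e else 0 := by
    intro e i j
    by_cases hij : i = j
    · subst hij; simp [hg, hD]
    · simp [hg, hij]
  rw [christoffel, hinv, Finset.sum_eq_single a]
  · simp only [hpd, Matrix.diagonal_apply_eq, @eq_comm _ a]; ring
  · intro d _ hd; rw [Matrix.diagonal_apply_ne' _ hd]; ring
  · simp

/-- The gradient of `f₀ τ² C²`. -/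
def confWarpGrad (k f₀ : ℝ) (x : Coord) (a : Fin 4) : ℝ :=
  f₀ * ((2 : ℕ) * x 0 ^ (2 - 1) * (Pi.single a 1 : Fin 4 → ℝ) 0) * (conf k x)⁻¹ ^ 2
    - 2 * f₀ * x 0 ^ 2 * confGrad k x a * (conf k x)⁻¹ ^ 3

/-- The diagonal components of the metric with `φ = f₀ τ²`. -/
def diagComp (k f₀ : ℝ) (ω : ℝ → ℝ → ℝ) (x : Coord) : Fin 4 → ℝ :=
  ![-1, ω (x 0) (x 1) ^ 2, f₀ * x 0 ^ 2 * ((conf k x)⁻¹) ^ 2, f₀ * x 0 ^ 2 * ((conf k x)⁻¹) ^ 2]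

/-- The Christoffel symbols of the metric with `φ = f₀ τ²`. -/
def christoffelTable (k f₀ : ℝ) (ω : ℝ → ℝ → ℝ) : Fin 4 → Fin 4 → Fin 4 → Coord → ℝ :=
  ![![![fun _ => 0, fun _ => 0, fun _ => 0, fun _ => 0],
      ![fun _ => 0, fun y => ω (y 0) (y 1) * timeD ω (y 0) (y 1), fun _ => 0, fun _ => 0],
      ![fun _ => 0, fun _ => 0, fun y => f₀ * y 0 ^ 1 * (conf k y)⁻¹ ^ 2, fun _ => 0],
      ![fun _ => 0, fun _ => 0, fun _ => 0, fun y => f₀ * y 0 ^ 1 * (conf k y)⁻¹ ^ 2]],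
    ![![fun _ => 0, fun y => timeD ω (y 0) (y 1) / ω (y 0) (y 1), fun _ => 0, fun _ => 0],
      ![fun y => timeD ω (y 0) (y 1) / ω (y 0) (y 1),
        fun y => radialD ω (y 0) (y 1) / ω (y 0) (y 1), fun _ => 0, fun _ => 0],
      ![fun _ => 0, fun _ => 0, fun _ => 0, fun _ => 0],
      ![fun _ => 0, fun _ => 0, fun _ => 0, fun _ => 0]],
    ![![fun _ => 0, fun _ => 0, fun y => (y 0)⁻¹, fun _ => 0],
      ![fun _ => 0, fun _ => 0, fun _ => 0, fun _ => 0],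
      ![fun y => (y 0)⁻¹, fun _ => 0, fun y => -(k / 2) * y 2 * (conf k y)⁻¹,
        fun y => -(k / 2) * y 3 * (conf k y)⁻¹],
      ![fun _ => 0, fun _ => 0, fun y => -(k / 2) * y 3 * (conf k y)⁻¹,
        fun y => (k / 2) * y 2 * (conf k y)⁻¹]],
    ![![fun _ => 0, fun _ => 0, fun _ => 0, fun y => (y 0)⁻¹],
      ![fun _ => 0, fun _ => 0, fun _ => 0, fun _ => 0],
      ![fun _ => 0, fun _ => 0, fun y => (k / 2) * y 3 * (conf k y)⁻¹,
        fun y => -(k / 2) * y 2 * (conf k y)⁻¹],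
      ![fun y => (y 0)⁻¹, fun _ => 0, fun y => -(k / 2) * y 2 * (conf k y)⁻¹,
        fun y => -(k / 2) * y 3 * (conf k y)⁻¹]]]

theorem christoffel_tMetric {k f₀ : ℝ} (hf₀ : f₀ ≠ 0) {ω : ℝ → ℝ → ℝ} {x : Coord}
    (h0 : x 0 ≠ 0) (hc : conf k x ≠ 0) (hω : ω (x 0) (x 1) ≠ 0)
    (hd : DifferentiableAt ℝ (Function.uncurry ω) (x 0, x 1)) (a b c : Fin 4) :
    christoffel (tMetric k (fun τ => f₀ * τ ^ 2) ω) a b c x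
      = christoffelTable k f₀ ω a b c x := by
  have hne : ∀ d, diagComp k f₀ ω x d ≠ 0 := by
    intro d; fin_cases d <;> simp [diagComp, h0, hc, hω, hf₀]
  have dt : DifferentiableAt ℝ (fun t => ω t (x 1)) (x 0) :=
    hd.comp (x 0) (f := fun t : ℝ => (t, x 1)) (by fun_prop)
  have dr : DifferentiableAt ℝ (fun r => ω (x 0) r) (x 1) :=
    hd.comp (x 1) (f := fun r : ℝ => (x 0, r)) (by fun_prop)
  have e1 : grad (fun t r => ω t r ^ 2) (x 0) (x 1)
      = ![2 * ω (x 0) (x 1) * timeD ω (x 0) (x 1), 2 * ω (x 0) (x 1) * radialD ω (x 0) (x 1),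
        0, 0] := by
    rw [grad, timeD, radialD, (dt.hasDerivAt.fun_pow 2).deriv, (dr.hasDerivAt.fun_pow 2).deriv]
    simp [timeD, radialD]
  have hD : ∀ i e, partialD e (fun y => diagComp k f₀ ω y i) x
      = (![0, grad (fun t r => ω t r ^ 2) (x 0) (x 1), confWarpGrad k f₀ x, confWarpGrad k f₀ x] :
        Fin 4 → Fin 4 → ℝ) i e := by
    intro i e
    fin_cases i
    · exact partialD_const e _ x
    · exact partialD_fun_coord (fun t r => ω t r ^ 2) e x
    -- `confWarpGrad` is written in the unsimplified shape of this lemma at `n = 2`, so the two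
    -- agree by definition.
    · exact partialD_coord_mul_inv_conf_sq hc f₀ 2 e 0
    · exact partialD_coord_mul_inv_conf_sq hc f₀ 2 e 0
  rw [christoffel_diagonal (g := tMetric k (fun τ => f₀ * τ ^ 2) ω) (h := diagComp k f₀ ω)
    (fun _ => rfl) hne hD, e1]
  clear hD e1 hne dt dr hd
  fin_cases a <;> fin_cases b <;> fin_cases c <;>
    simp [christoffelTable, diagComp, confGrad, confWarpGrad] <;> field_simp

/-- The Ricci tensor of the metric with `φ = f₀ τ²`. -/
def ricciTable (k f₀ : ℝ) (ω : ℝ → ℝ → ℝ) (x : Coord) : Fin 4 → ℝ :=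
  ![-timeD (timeD ω) (x 0) (x 1) / ω (x 0) (x 1),
    ω (x 0) (x 1) * timeD (timeD ω) (x 0) (x 1)
      + 2 * ω (x 0) (x 1) * timeD ω (x 0) (x 1) / x 0,
    (conf k x)⁻¹ ^ 2 * (f₀ + k + f₀ * x 0 * timeD ω (x 0) (x 1) / ω (x 0) (x 1)),
    (conf k x)⁻¹ ^ 2 * (f₀ + k + f₀ * x 0 * timeD ω (x 0) (x 1) / ω (x 0) (x 1))]

/-! ### Calculus of functions of `τ` and `r` -/

section TwoVariables

variable {ω : ℝ → ℝ → ℝ} {τ r : ℝ}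

theorem differentiableAt_time_slice {F : ℝ → ℝ → ℝ}
    (hd : DifferentiableAt ℝ (Function.uncurry F) (τ, r)) :
    DifferentiableAt ℝ (fun t => F t r) τ :=
  hd.comp τ (f := fun t : ℝ => (t, r)) (by fun_prop)

theorem differentiableAt_radial_slice {F : ℝ → ℝ → ℝ}
    (hd : DifferentiableAt ℝ (Function.uncurry F) (τ, r)) :
    DifferentiableAt ℝ (fun s => F τ s) r :=
  hd.comp r (f := fun s : ℝ => (τ, s)) (by fun_prop)

theorem timeD_eq_fderiv {F : ℝ → ℝ → ℝ} (hd : DifferentiableAt ℝ (Function.uncurry F) (τ, r)) :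
    timeD F τ r = fderiv ℝ (Function.uncurry F) (τ, r) (1, 0) := by
  have h : HasDerivAt (fun t : ℝ => (t, r)) (1, 0) τ :=
    (hasDerivAt_id' τ).prodMk (hasDerivAt_const τ r)
  exact (hd.hasFDerivAt.comp_hasDerivAt τ h).deriv

theorem radialD_eq_fderiv {F : ℝ → ℝ → ℝ} (hd : DifferentiableAt ℝ (Function.uncurry F) (τ, r)) :
    radialD F τ r = fderiv ℝ (Function.uncurry F) (τ, r) (0, 1) := by
  have h : HasDerivAt (fun s : ℝ => (τ, s)) (0, 1) r :=
    (hasDerivAt_const r τ).prodMk (hasDerivAt_id' r)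
  exact (hd.hasFDerivAt.comp_hasDerivAt r h).deriv

theorem eventually_differentiableAt (hω : ContDiffAt ℝ 2 (Function.uncurry ω) (τ, r)) :
    ∀ᶠ z in 𝓝 (τ, r), DifferentiableAt ℝ (Function.uncurry ω) z :=
  (hω.eventually (by simp)).mono fun _ h => h.differentiableAt (by simp)

theorem eventually_uncurry_timeD (hω : ContDiffAt ℝ 2 (Function.uncurry ω) (τ, r)) :
    Function.uncurry (timeD ω) =ᶠ[𝓝 (τ, r)]
      fun z => fderiv ℝ (Function.uncurry ω) z (1, 0) :=
  (eventually_differentiableAt hω).mono fun _ h => timeD_eq_fderiv h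

theorem eventually_uncurry_radialD (hω : ContDiffAt ℝ 2 (Function.uncurry ω) (τ, r)) :
    Function.uncurry (radialD ω) =ᶠ[𝓝 (τ, r)]
      fun z => fderiv ℝ (Function.uncurry ω) z (0, 1) :=
  (eventually_differentiableAt hω).mono fun _ h => radialD_eq_fderiv h

theorem differentiableAt_fderiv (hω : ContDiffAt ℝ 2 (Function.uncurry ω) (τ, r)) :
    DifferentiableAt ℝ (fderiv ℝ (Function.uncurry ω)) (τ, r) :=
  (hω.fderiv_right (m := 1) (by norm_num)).differentiableAt (by simp)

theorem differentiableAt_timeD (hω : ContDiffAt ℝ 2 (Function.uncurry ω) (τ, r)) :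
    DifferentiableAt ℝ (Function.uncurry (timeD ω)) (τ, r) :=
  ((differentiableAt_fderiv hω).clm_apply
    (differentiableAt_const _)).congr_of_eventuallyEq (eventually_uncurry_timeD hω)

theorem differentiableAt_radialD (hω : ContDiffAt ℝ 2 (Function.uncurry ω) (τ, r)) :
    DifferentiableAt ℝ (Function.uncurry (radialD ω)) (τ, r) :=
  ((differentiableAt_fderiv hω).clm_apply
    (differentiableAt_const _)).congr_of_eventuallyEq (eventually_uncurry_radialD hω)

/-- Needed for `R_10`, which contains `∂_r (ω_τ/ω) - ∂_τ (ω_r/ω)`. -/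
theorem timeD_radialD_comm (hω : ContDiffAt ℝ 2 (Function.uncurry ω) (τ, r)) :
    timeD (radialD ω) τ r = radialD (timeD ω) τ r := by
  have hs : IsSymmSndFDerivAt ℝ (Function.uncurry ω) (τ, r) :=
    hω.isSymmSndFDerivAt (by simp)
  have hf := (differentiableAt_fderiv hω).hasFDerivAt
  rw [timeD_eq_fderiv (differentiableAt_radialD hω), radialD_eq_fderiv (differentiableAt_timeD hω),
    (eventually_uncurry_radialD hω).fderiv_eq, (eventually_uncurry_timeD hω).fderiv_eq,
    (hf.clm_apply (hasFDerivAt_const _ _)).fderiv, (hf.clm_apply (hasFDerivAt_const _ _)).fderiv]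
  simpa using hs.eq (1, 0) (0, 1)

theorem grad_mul {F G : ℝ → ℝ → ℝ} (hF : DifferentiableAt ℝ (Function.uncurry F) (τ, r))
    (hG : DifferentiableAt ℝ (Function.uncurry G) (τ, r)) :
    grad (fun t s => F t s * G t s) τ r
      = ![timeD F τ r * G τ r + F τ r * timeD G τ r,
          radialD F τ r * G τ r + F τ r * radialD G τ r, 0, 0] := by
  rw [grad, timeD, radialD,
    ((differentiableAt_time_slice hF).hasDerivAt.fun_mul
      (differentiableAt_time_slice hG).hasDerivAt).deriv,
    ((differentiableAt_radial_slice hF).hasDerivAt.fun_mul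
      (differentiableAt_radial_slice hG).hasDerivAt).deriv]
  rfl

theorem grad_div {F G : ℝ → ℝ → ℝ} (hF : DifferentiableAt ℝ (Function.uncurry F) (τ, r))
    (hG : DifferentiableAt ℝ (Function.uncurry G) (τ, r)) (h0 : G τ r ≠ 0) :
    grad (fun t s => F t s / G t s) τ r
      = ![(timeD F τ r * G τ r - F τ r * timeD G τ r) / G τ r ^ 2,
          (radialD F τ r * G τ r - F τ r * radialD G τ r) / G τ r ^ 2, 0, 0] := by
  rw [grad, timeD, radialD,
    ((differentiableAt_time_slice hF).hasDerivAt.fun_div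
      (differentiableAt_time_slice hG).hasDerivAt h0).deriv,
    ((differentiableAt_radial_slice hF).hasDerivAt.fun_div
      (differentiableAt_radial_slice hG).hasDerivAt h0).deriv]
  rfl

end TwoVariables

/-! ### Ricci tensor -/

/-- The hypotheses of `christoffel_tMetric` persist near `x`, so the table may be differentiated in
place of the symbols. -/
theorem partialD_christoffel {k f₀ : ℝ} (hf₀ : f₀ ≠ 0) {ω : ℝ → ℝ → ℝ} {x : Coord}
    (h0 : x 0 ≠ 0) (hc : conf k x ≠ 0) (hω : ω (x 0) (x 1) ≠ 0)
    (hd : ContDiffAt ℝ 2 (Function.uncurry ω) (x 0, x 1)) (a b c d : Fin 4) :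
    partialD d (christoffel (tMetric k (fun τ => f₀ * τ ^ 2) ω) a b c) x
      = partialD d (christoffelTable k f₀ ω a b c) x := by
  apply partialD_congr
  have hp : ContinuousAt (fun y : Coord => (y 0, y 1)) x := by fun_prop
  have e1 : ∀ᶠ y : Coord in 𝓝 x, y 0 ≠ 0 :=
    (continuous_apply 0).continuousAt.eventually_ne h0
  have e2 : ∀ᶠ y : Coord in 𝓝 x, conf k y ≠ 0 := by
    have : ContinuousAt (conf k) x := by unfold conf; fun_prop
    exact this.eventually_ne hc
  have e3 : ∀ᶠ y : Coord in 𝓝 x, ω (y 0) (y 1) ≠ 0 :=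
    (ContinuousAt.comp (f := fun y : Coord => (y 0, y 1)) hd.continuousAt hp).eventually_ne hω
  have e4 : ∀ᶠ y : Coord in 𝓝 x, DifferentiableAt ℝ (Function.uncurry ω) (y 0, y 1) :=
    hp.eventually (eventually_differentiableAt hd)
  filter_upwards [e1, e2, e3, e4] with y h1 h2 h3 h4
  exact christoffel_tMetric hf₀ h1 h2 h3 h4 a b c

theorem ricci_tMetric {k f₀ : ℝ} (hf₀ : f₀ ≠ 0) {ω : ℝ → ℝ → ℝ} {x : Coord}
    (h0 : x 0 ≠ 0) (hc : conf k x ≠ 0) (hω : ω (x 0) (x 1) ≠ 0)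
    (hd : ContDiffAt ℝ 2 (Function.uncurry ω) (x 0, x 1)) (b c : Fin 4) :
    ricci (tMetric k (fun τ => f₀ * τ ^ 2) ω) b c x
      = Matrix.diagonal (ricciTable k f₀ ω x) b c := by
  have hd1 : DifferentiableAt ℝ (Function.uncurry ω) (x 0, x 1) := hd.differentiableAt (by simp)
  have E1 : ∀ e, partialD e (fun y => ω (y 0) (y 1) * timeD ω (y 0) (y 1)) x = _ := fun e =>
    (partialD_fun_coord (fun t s => ω t s * timeD ω t s) e x).trans
      (congrFun (grad_mul hd1 (differentiableAt_timeD hd)) e)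
  have E2 : ∀ e, partialD e (fun y => timeD ω (y 0) (y 1) / ω (y 0) (y 1)) x = _ := fun e =>
    (partialD_fun_coord (fun t s => timeD ω t s / ω t s) e x).trans
      (congrFun (grad_div (differentiableAt_timeD hd) hd1 hω) e)
  have E3 : ∀ e, partialD e (fun y => radialD ω (y 0) (y 1) / ω (y 0) (y 1)) x = _ := fun e =>
    (partialD_fun_coord (fun t s => radialD ω t s / ω t s) e x).trans
      (congrFun (grad_div (differentiableAt_radialD hd) hd1 hω) e)
  -- The exponent `1` matches the factor `y 0 ^ 1` kept in `christoffelTable`.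
  have E4 := partialD_coord_mul_inv_conf_sq hc f₀ 1
  have E5 := partialD_inv_coord 0 h0
  have E6 := fun c a i => partialD_coord_mul_inv_conf hc c a i
  have hs := timeD_radialD_comm hd
  have hconf : conf k x = 1 + k / 4 * (x 2 ^ 2 + x 3 ^ 2) := rfl
  have hch := christoffel_tMetric hf₀ h0 hc hω hd1
  simp only [ricci, ricciTable, hch, partialD_christoffel hf₀ h0 hc hω hd]
  clear hch hd hd1
  fin_cases b <;> fin_cases c <;>
    simp only [Fin.sum_univ_four, christoffelTable, Matrix.diagonal_apply,
      Fin.reduceFinMk, Fin.zero_eta, Fin.mk_one, Fin.isValue, Matrix.cons_val,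
      E1, E2, E3, E4, E5, E6, partialD_const, confGrad, hs]
  -- The conformal factor is an atom while denominators are cleared; its formula enters only in the
  -- final `ring`.
  all_goals generalize conf k x = C at *
  all_goals simp
  all_goals try field_simp
  all_goals try (subst hconf; ring)

/-- The Einstein tensor of the metric with `φ = f₀ τ²`. -/
def einsteinTable (k f₀ : ℝ) (ω : ℝ → ℝ → ℝ) (x : Coord) : Fin 4 → ℝ :=
  ![2 * timeD ω (x 0) (x 1) / (ω (x 0) (x 1) * x 0) + (1 + k / f₀) / x 0 ^ 2,
    -((1 + k / f₀) / x 0 ^ 2) * ω (x 0) (x 1) ^ 2,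
    -(timeD (timeD ω) (x 0) (x 1) / ω (x 0) (x 1)
      + timeD ω (x 0) (x 1) / (ω (x 0) (x 1) * x 0)) * (f₀ * x 0 ^ 2 * (conf k x)⁻¹ ^ 2),
    -(timeD (timeD ω) (x 0) (x 1) / ω (x 0) (x 1)
      + timeD ω (x 0) (x 1) / (ω (x 0) (x 1) * x 0)) * (f₀ * x 0 ^ 2 * (conf k x)⁻¹ ^ 2)]

/-! ### Einstein tensor and field equations -/

section Einstein

variable {k f₀ : ℝ} {ω : ℝ → ℝ → ℝ} {x : Coord}

theorem scalarCurvature_tMetric (hf₀ : f₀ ≠ 0) (h0 : x 0 ≠ 0) (hc : conf k x ≠ 0)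
    (hω : ω (x 0) (x 1) ≠ 0) (hd : ContDiffAt ℝ 2 (Function.uncurry ω) (x 0, x 1)) :
    scalarCurvature (tMetric k (fun τ => f₀ * τ ^ 2) ω) x
      = 2 * timeD (timeD ω) (x 0) (x 1) / ω (x 0) (x 1)
        + 4 * timeD ω (x 0) (x 1) / (ω (x 0) (x 1) * x 0) + 2 * (1 + k / f₀) / x 0 ^ 2 := by
  have hinv : (tMetric k (fun τ => f₀ * τ ^ 2) ω x)⁻¹
      = Matrix.diagonal (fun d => (diagComp k f₀ ω x d)⁻¹) := by
    apply Matrix.inv_eq_right_inv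
    change Matrix.diagonal (diagComp k f₀ ω x) * _ = _
    rw [Matrix.diagonal_mul_diagonal, ← Matrix.diagonal_one]
    congr 1; funext d
    apply mul_inv_cancel₀
    fin_cases d <;> simp [diagComp, h0, hc, hω, hf₀]
  simp only [scalarCurvature, hinv, ricci_tMetric hf₀ h0 hc hω hd]
  simp [Fin.sum_univ_four, Matrix.diagonal_apply, ricciTable, diagComp]
  field_simp
  ring

theorem einstein_tMetric (hf₀ : f₀ ≠ 0) (h0 : x 0 ≠ 0) (hc : conf k x ≠ 0)
    (hω : ω (x 0) (x 1) ≠ 0) (hd : ContDiffAt ℝ 2 (Function.uncurry ω) (x 0, x 1))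
    (a b : Fin 4) :
    einstein (tMetric k (fun τ => f₀ * τ ^ 2) ω) a b x
      = Matrix.diagonal (einsteinTable k f₀ ω x) a b := by
  have hg : tMetric k (fun τ => f₀ * τ ^ 2) ω x = Matrix.diagonal (diagComp k f₀ ω x) := rfl
  rw [einstein, ricci_tMetric hf₀ h0 hc hω hd, scalarCurvature_tMetric hf₀ h0 hc hω hd, hg]
  by_cases hab : a = b
  · subst hab
    simp only [Matrix.diagonal_apply_eq]
    fin_cases a <;> simp [ricciTable, diagComp, einsteinTable] <;> field_simp <;> ring
  · simp [Matrix.diagonal_apply_ne _ hab]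

theorem lower_comoving (k : ℝ) (φ : ℝ → ℝ) (ω : ℝ → ℝ → ℝ) (x : Coord) (a : Fin 4) :
    lower (tMetric k φ ω) comoving a x = (![-1, 0, 0, 0] : Fin 4 → ℝ) a := by
  fin_cases a <;> simp [lower, comoving, tMetric, Matrix.diagonal_apply]

/-- The Einstein equations for a comoving perfect fluid at an event. -/
theorem perfectFluid_at_iff (hf₀ : f₀ ≠ 0) (h0 : x 0 ≠ 0) (hc : conf k x ≠ 0)
    (hω : ω (x 0) (x 1) ≠ 0) (hd : ContDiffAt ℝ 2 (Function.uncurry ω) (x 0, x 1))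
    (ρ p : Coord → ℝ) :
    (∑ a, lower (tMetric k (fun τ => f₀ * τ ^ 2) ω) comoving a x * comoving x a = -1 ∧
      ∀ a b, einstein (tMetric k (fun τ => f₀ * τ ^ 2) ω) a b x
        = (ρ x + p x) * lower (tMetric k (fun τ => f₀ * τ ^ 2) ω) comoving a x
            * lower (tMetric k (fun τ => f₀ * τ ^ 2) ω) comoving b x
          + p x * tMetric k (fun τ => f₀ * τ ^ 2) ω x a b) ↔
      p x = -((1 + k / f₀) / x 0 ^ 2) ∧
      ρ x = (1 + k / f₀) / x 0 ^ 2 + 2 * timeD ω (x 0) (x 1) / (ω (x 0) (x 1) * x 0) ∧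
      x 0 ^ 2 * timeD (timeD ω) (x 0) (x 1) + x 0 * timeD ω (x 0) (x 1)
        = (1 + k / f₀) * ω (x 0) (x 1) := by
  have hg : tMetric k (fun τ => f₀ * τ ^ 2) ω x = Matrix.diagonal (diagComp k f₀ ω x) := rfl
  simp only [lower_comoving, einstein_tMetric hf₀ h0 hc hω hd, hg]
  generalize hM : 1 + k / f₀ = M
  constructor
  -- The 11 component gives `p`, the 00 component gives `ρ`, and the 22 component with this `p` is
  -- the Euler equation.
  · rintro ⟨-, h⟩
    have g0 := h 0 0
    have g1 := h 1 1
    have g2 := h 2 2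
    simp [einsteinTable, diagComp, hM] at g0 g1 g2
    have hp : p x = -(M / x 0 ^ 2) := by
      apply mul_right_cancel₀ (pow_ne_zero 2 hω); linarith
    refine ⟨hp, by linarith, ?_⟩
    have g2' := g2.resolve_right (by simp [hf₀, h0, hc])
    rw [hp] at g2'
    field_simp at g2'
    linear_combination -g2'
  · rintro ⟨hp, hρ, hode⟩
    refine ⟨by simp [Fin.sum_univ_four, comoving], fun a b => ?_⟩
    by_cases hab : a = b
    · subst hab
      simp only [Matrix.diagonal_apply_eq]
      have key : timeD (timeD ω) (x 0) (x 1) / ω (x 0) (x 1)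
          + timeD ω (x 0) (x 1) / (ω (x 0) (x 1) * x 0) = M / x 0 ^ 2 := by
        field_simp; linear_combination hode
      fin_cases a <;> simp [einsteinTable, diagComp, hM, key, hp, hρ]
    · rw [Matrix.diagonal_apply_ne _ hab, Matrix.diagonal_apply_ne _ hab]
      have : (![-1, 0, 0, 0] : Fin 4 → ℝ) a * (![-1, 0, 0, 0] : Fin 4 → ℝ) b = 0 := by
        fin_cases a <;> fin_cases b <;> simp at hab ⊢
      rw [mul_assoc, this]; ring

end Einstein

/-! ### The Euler equation -/

section EulerEquation

variable {m : ℝ}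

/-- `Real.log t = Real.log |t|`, so one exponential formula covers both signs of `τ`. -/
theorem hasDerivAt_abs_rpow (c : ℝ) {τ : ℝ} (hτ : τ ≠ 0) :
    HasDerivAt (fun t => |t| ^ c) (c * |τ| ^ c / τ) τ := by
  have e : (fun t => |t| ^ c) =ᶠ[𝓝 τ] fun t => Real.exp (Real.log t * c) := by
    filter_upwards [isOpen_ne.mem_nhds hτ] with t ht
    rw [Real.rpow_def_of_pos (abs_pos.2 ht), Real.log_abs]
  refine HasDerivAt.congr_of_eventuallyEq (HasDerivAt.congr_deriv
    ((Real.hasDerivAt_log hτ).mul_const c).exp ?_) e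
  rw [Real.rpow_def_of_pos (abs_pos.2 hτ), Real.log_abs]
  ring

theorem abs_rpow_mul_neg {τ : ℝ} (hτ : τ ≠ 0) (c : ℝ) : |τ| ^ c * |τ| ^ (-c) = 1 := by
  rw [← Real.rpow_add (abs_pos.2 hτ)]; simp

/-- Solutions of the Euler equation `τ² f'' + τ f' = m² f` away from `τ = 0`. -/
theorem euler_equation_solution (hm : m ≠ 0) {I : Set ℝ} (hI : IsOpen I) (hIc : IsPreconnected I)
    (h0 : (0 : ℝ) ∉ I) {f f' f'' : ℝ → ℝ} (hf : ∀ t ∈ I, HasDerivAt f (f' t) t)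
    (hf' : ∀ t ∈ I, HasDerivAt f' (f'' t) t)
    (hode : ∀ t ∈ I, t ^ 2 * f'' t + t * f' t = m ^ 2 * f t) :
    ∃ a b, ∀ t ∈ I, f t = |t| ^ m * a + |t| ^ (-m) * b := by
  have hne : ∀ t ∈ I, t ≠ 0 := fun t ht h => h0 (h ▸ ht)
  -- First integrals from the factorisation `(t d/dt - c)(t d/dt + c)` of the Euler operator. For `f
  -- = |t|^m a + |t|^(-m) b` they equal `2 m a` at `c = m` and `-2 m b` at `c = -m`, whence the
  -- witnesses below.
  have hconst : ∀ c : ℝ, c ^ 2 = m ^ 2 →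
      ∃ a, ∀ t ∈ I, |t| ^ (-c) * (c * f t + t * f' t) = a := by
    intro c hc
    have hd : ∀ t ∈ I, HasDerivAt (fun t => |t| ^ (-c) * (c * f t + t * f' t)) 0 t := by
      intro t ht
      refine ((hasDerivAt_abs_rpow (-c) (hne t ht)).fun_mul (((hf t ht).const_mul c).fun_add
        ((hasDerivAt_id' t).fun_mul (hf' t ht)))).congr_deriv ?_
      have := hne t ht
      have ho := hode t ht
      field_simp
      linear_combination |t| ^ (-c) * (ho - f t * hc)
    exact hI.exists_is_const_of_deriv_eq_zero hIc
      (fun t ht => (hd t ht).differentiableAt.differentiableWithinAt) fun t ht => (hd t ht).deriv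
  obtain ⟨a, ha⟩ := hconst m rfl
  obtain ⟨b, hb⟩ := hconst (-m) (by ring)
  refine ⟨a / (2 * m), -b / (2 * m), fun t ht => ?_⟩
  rw [← ha t ht, ← hb t ht, neg_neg]
  have h1 := abs_rpow_mul_neg (hne t ht) m
  field_simp
  linear_combination (-2 * m * f t) * h1

theorem timeD_of_eventually {ω : ℝ → ℝ → ℝ} {τ r a b : ℝ} (hτ : τ ≠ 0)
    (h : ∀ᶠ t in 𝓝 τ, ω t r = |t| ^ m * a + |t| ^ (-m) * b) :
    timeD ω τ r = m / τ * (|τ| ^ m * a - |τ| ^ (-m) * b) := by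
  rw [timeD, EventuallyEq.deriv_eq h, (((hasDerivAt_abs_rpow m hτ).mul_const a).fun_add
    ((hasDerivAt_abs_rpow (-m) hτ).mul_const b)).deriv]
  ring

theorem euler_equation_of_eventually {ω : ℝ → ℝ → ℝ} {τ r a b : ℝ} (hτ : τ ≠ 0)
    (h : ∀ᶠ t in 𝓝 τ, ω t r = |t| ^ m * a + |t| ^ (-m) * b) :
    τ ^ 2 * timeD (timeD ω) τ r + τ * timeD ω τ r = m ^ 2 * ω τ r := by
  have e : (fun t => timeD ω t r) =ᶠ[𝓝 τ]
      fun t => m * t⁻¹ * (|t| ^ m * a - |t| ^ (-m) * b) := by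
    filter_upwards [h.eventually_nhds, isOpen_ne.mem_nhds hτ] with t h1 h2
    rw [timeD_of_eventually h2 h1]; rfl
  rw [timeD_of_eventually hτ h, h.self_of_nhds, timeD, e.deriv_eq,
    (((hasDerivAt_inv hτ).const_mul m).fun_mul (((hasDerivAt_abs_rpow m hτ).mul_const a).fun_sub
    ((hasDerivAt_abs_rpow (-m) hτ).mul_const b))).deriv]
  field_simp
  ring

/-- Differentiating the relation flips the sign of its second term; the sum and difference of the
two relations separate `a` from `b`. -/
theorem abs_rpow_linearIndependent (hm : m ≠ 0) {I : Set ℝ} (hI : IsOpen I) (hne : I.Nonempty)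
    (h0 : (0 : ℝ) ∉ I) {a b : ℝ} (h : ∀ τ ∈ I, a * |τ| ^ m + b * |τ| ^ (-m) = 0) :
    a = 0 ∧ b = 0 := by
  obtain ⟨τ, hτ⟩ := hne
  have hτ0 : τ ≠ 0 := fun e => h0 (e ▸ hτ)
  have e : ∀ᶠ t in 𝓝 τ, (0 : ℝ) = |t| ^ m * a + |t| ^ (-m) * b := by
    filter_upwards [hI.mem_nhds hτ] with t ht
    rw [← h t ht]; ring
  have h1 := timeD_of_eventually (ω := fun _ _ => 0) (r := 0) hτ0 e
  have h2 := h τ hτ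
  have p1 : 0 < |τ| ^ m := Real.rpow_pos_of_pos (abs_pos.2 hτ0) _
  have p2 : 0 < |τ| ^ (-m) := Real.rpow_pos_of_pos (abs_pos.2 hτ0) _
  have h3 : |τ| ^ m * a - |τ| ^ (-m) * b = 0 := by
    simpa [timeD, hm, hτ0] using h1.symm
  constructor
  · have : |τ| ^ m * a = 0 := by linarith
    simpa [p1.ne'] using this
  · have : |τ| ^ (-m) * b = 0 := by linarith
    simpa [p2.ne'] using this

end EulerEquation

/-! ### Classification of the T-models with `φ = f₀ τ²` -/

theorem isPerfectFluidSolution_tMetric_iff {k f₀ m : ℝ} (hf₀ : f₀ ≠ 0) (hm : m ^ 2 = 1 + k / f₀)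
    {ω : ℝ → ℝ → ℝ} {D : Set Coord} (h0 : ∀ x ∈ D, x 0 ≠ 0) (hc : ∀ x ∈ D, conf k x ≠ 0)
    (hω : ∀ x ∈ D, ω (x 0) (x 1) ≠ 0)
    (hd : ∀ x ∈ D, ContDiffAt ℝ 2 (Function.uncurry ω) (x 0, x 1)) (ρ p : Coord → ℝ) :
    IsPerfectFluidSolution (tMetric k (fun τ => f₀ * τ ^ 2) ω) comoving ρ p D ↔
      ∀ x ∈ D, p x = -(m ^ 2 / x 0 ^ 2) ∧
        ρ x = m ^ 2 / x 0 ^ 2 + 2 * timeD ω (x 0) (x 1) / (ω (x 0) (x 1) * x 0) ∧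
        x 0 ^ 2 * timeD (timeD ω) (x 0) (x 1) + x 0 * timeD ω (x 0) (x 1)
          = m ^ 2 * ω (x 0) (x 1) := by
  rw [hm]
  exact forall₂_congr fun x hx =>
    perfectFluid_at_iff hf₀ (h0 x hx) (hc x hx) (hω x hx) (hd x hx) ρ p

theorem exists_perfectFluid_iff {k f₀ m : ℝ} (hf₀ : f₀ ≠ 0) (hm0 : m ≠ 0)
    (hm : m ^ 2 = 1 + k / f₀) {I J : Set ℝ} {ω : ℝ → ℝ → ℝ} (hI : IsOpen I)
    (hIc : IsPreconnected I) (h0 : (0 : ℝ) ∉ I) (hJ : IsOpen J)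
    (hd : ContDiffOn ℝ 2 (Function.uncurry ω) (I ×ˢ J)) (hω : ∀ τ ∈ I, ∀ r ∈ J, ω τ r ≠ 0) :
    (∃ ρ p : Coord → ℝ, IsPerfectFluidSolution (tMetric k (fun τ => f₀ * τ ^ 2) ω)
        comoving ρ p {x | x 0 ∈ I ∧ x 1 ∈ J ∧ conf k x ≠ 0}) ↔
      ∃ Q₁ Q₂ : ℝ → ℝ, ∀ τ ∈ I, ∀ r ∈ J, ω τ r = |τ| ^ m * Q₁ r + |τ| ^ (-m) * Q₂ r := by
  have hne : ∀ t ∈ I, t ≠ 0 := fun t ht h => h0 (h ▸ ht)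
  have hda : ∀ τ ∈ I, ∀ r ∈ J, ContDiffAt ℝ 2 (Function.uncurry ω) (τ, r) := fun τ hτ r hr =>
    hd.contDiffAt ((hI.prod hJ).mem_nhds ⟨hτ, hr⟩)
  have hiff := isPerfectFluidSolution_tMetric_iff hf₀ hm (ω := ω)
    (D := {x | x 0 ∈ I ∧ x 1 ∈ J ∧ conf k x ≠ 0}) (fun x hx => hne _ hx.1) (fun x hx => hx.2.2)
    (fun x hx => hω _ hx.1 _ hx.2.1) (fun x hx => hda _ hx.1 _ hx.2.1)
  simp only [hiff]
  constructor
  · rintro ⟨ρ, p, h⟩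
    have hsol : ∀ r, ∃ a b, r ∈ J → ∀ t ∈ I, ω t r = |t| ^ m * a + |t| ^ (-m) * b := by
      intro r
      by_cases hr : r ∈ J
      · obtain ⟨a, b, hab⟩ := euler_equation_solution hm0 hI hIc h0 (f := fun t => ω t r)
          (f' := fun t => timeD ω t r) (f'' := fun t => timeD (timeD ω) t r)
          (fun t ht => (differentiableAt_time_slice
            ((hda t ht r hr).differentiableAt (by simp))).hasDerivAt)
          (fun t ht => (differentiableAt_time_slice
            (differentiableAt_timeD (hda t ht r hr))).hasDerivAt)
          (fun t ht => by
            -- At `x = y = 0` the conformal factor is `1`, so this event lies in the domain for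
            -- every `k`.
            simpa using (h ![t, r, 0, 0] ⟨ht, hr, by simp [conf]⟩).2.2)
        exact ⟨a, b, fun _ => hab⟩
      · exact ⟨0, 0, fun h => absurd h hr⟩
    choose Q₁ Q₂ hQ using hsol
    exact ⟨Q₁, Q₂, fun τ hτ r hr => hQ r hr τ hτ⟩
  · rintro ⟨Q₁, Q₂, hQ⟩
    -- `ρ` and `p` are defined by the formulas they must satisfy; only the Euler equation is left.
    refine ⟨_, _, fun x hx => ⟨rfl, rfl, euler_equation_of_eventually (a := Q₁ (x 1))
      (b := Q₂ (x 1)) (hne _ hx.1) ?_⟩⟩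
    filter_upwards [hI.mem_nhds hx.1] with t ht
    exact hQ t ht _ hx.2.1

/-! ### The models `ω = ω₁ + ω₂ Q` -/

section Models

variable {m : ℝ} {Q : ℝ → ℝ}

theorem abs_rpow_two_mul {τ : ℝ} (hτ : τ ≠ 0) : |τ| ^ (2 * m) = |τ| ^ m * |τ| ^ m := by
  rw [two_mul, Real.rpow_add (abs_pos.2 hτ)]

theorem mwhOmega_mul {τ : ℝ} (hτ : τ ≠ 0) (r : ℝ) :
    |τ| ^ m * mwhOmega m Q τ r = |τ| ^ (2 * m) + Q r := by
  rw [mwhOmega, abs_rpow_two_mul hτ]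
  linear_combination Q r * abs_rpow_mul_neg hτ m

theorem add_ne_zero_of_mwhOmega {τ r : ℝ} (hτ : τ ≠ 0) (hω : mwhOmega m Q τ r ≠ 0) :
    |τ| ^ (2 * m) + Q r ≠ 0 := by
  rw [← mwhOmega_mul hτ]
  exact mul_ne_zero (Real.rpow_pos_of_pos (abs_pos.2 hτ) m).ne' hω

theorem contDiffAt_mwhOmega {τ r : ℝ} (hτ : τ ≠ 0) (hQ : ContDiffAt ℝ 2 Q r) :
    ContDiffAt ℝ 2 (Function.uncurry (mwhOmega m Q)) (τ, r) := by
  have habs : ContDiffAt ℝ 2 (fun z : ℝ × ℝ => |z.1|) (τ, r) :=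
    (contDiffAt_abs hτ).comp (τ, r) contDiffAt_fst
  have hp : ∀ c : ℝ, ContDiffAt ℝ 2 (fun z : ℝ × ℝ => |z.1| ^ c) (τ, r) := fun c =>
    habs.rpow_const_of_ne (abs_pos.2 hτ).ne'
  have hQ' : ContDiffAt ℝ 2 (fun z : ℝ × ℝ => Q z.2) (τ, r) :=
    ContDiffAt.comp (τ, r) (f := Prod.snd) (g := Q) hQ contDiffAt_snd
  exact (hp m).add ((hp (-m)).mul hQ')

/-- The ratio `(ω₁ - ω₂ Q) / (ω₁ + ω₂ Q)`. -/
def mwhRatio (m : ℝ) (Q : ℝ → ℝ) (τ r : ℝ) : ℝ :=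
  (|τ| ^ (2 * m) - Q r) / (|τ| ^ (2 * m) + Q r)

theorem mwh_isPerfectFluidSolution_iff {k f₀ : ℝ} (hf₀ : f₀ ≠ 0) (hm0 : m ≠ 0)
    (hm : m ^ 2 = 1 + k / f₀) {J : Set ℝ} (hJ : IsOpen J) (hQ : ContDiffOn ℝ 2 Q J)
    (ρ p : Coord → ℝ) :
    IsPerfectFluidSolution (mwhMetric k f₀ m Q) comoving ρ p (mwhDomain k m Q J) ↔
      ∀ x ∈ mwhDomain k m Q J, p x = -(m ^ 2 / x 0 ^ 2) ∧
        ρ x = m ^ 2 / x 0 ^ 2 * (1 + 2 / m * mwhRatio m Q (x 0) (x 1)) := by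
  rw [mwhMetric, isPerfectFluidSolution_tMetric_iff hf₀ hm (fun x hx => hx.1)
    (fun x hx => hx.2.2.1) (fun x hx => hx.2.2.2)
    (fun x hx => contDiffAt_mwhOmega hx.1 (hQ.contDiffAt (hJ.mem_nhds hx.2.1)))]
  refine forall₂_congr fun x hx => ?_
  obtain ⟨h0, -, -, hω⟩ := hx
  have he : ∀ᶠ t in 𝓝 (x 0), mwhOmega m Q t (x 1) = |t| ^ m * 1 + |t| ^ (-m) * Q (x 1) :=
    Eventually.of_forall fun t => by simp [mwhOmega]
  have hode := euler_equation_of_eventually h0 he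
  have hp := Real.rpow_pos_of_pos (abs_pos.2 h0) m
  have hρ : m ^ 2 / x 0 ^ 2 + 2 * timeD (mwhOmega m Q) (x 0) (x 1)
        / (mwhOmega m Q (x 0) (x 1) * x 0)
      = m ^ 2 / x 0 ^ 2 * (1 + 2 / m * mwhRatio m Q (x 0) (x 1)) := by
    have hn : |x 0| ^ (2 * m) - Q (x 1)
        = |x 0| ^ m * (|x 0| ^ m * 1 - |x 0| ^ (-m) * Q (x 1)) := by
      rw [abs_rpow_two_mul h0]
      linear_combination Q (x 1) * abs_rpow_mul_neg h0 m
    rw [timeD_of_eventually h0 he, mwhRatio, ← mwhOmega_mul h0, hn]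
    field_simp
  rw [hρ]
  tauto

/-- Riccati form of the Euler equation: `m s` is the logarithmic derivative `τ ω'/ω`. -/
theorem hasDerivAt_mwhRatio {τ r : ℝ} (hτ : τ ≠ 0) (hω : mwhOmega m Q τ r ≠ 0) :
    HasDerivAt (fun t => mwhRatio m Q t r) (m / τ * (1 - mwhRatio m Q τ r ^ 2)) τ := by
  have hn := add_ne_zero_of_mwhOmega hτ hω
  have h := hasDerivAt_abs_rpow (2 * m) hτ
  refine ((h.sub_const (Q r)).fun_div (h.add_const (Q r)) hn).congr_deriv ?_
  rw [mwhRatio]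
  field_simp
  ring

theorem along_comoving (q : Coord → ℝ) (x : Coord) : along comoving q x = partialD 0 q x := by
  simp [along, comoving, Pi.single_apply]

/-- Numerator and denominator add up to `2 |τ|^(2m) > 0`, so they cannot both be negative. -/
theorem mwhRatio_pos_iff {τ r : ℝ} (hτ : τ ≠ 0) :
    0 < mwhRatio m Q τ r ↔ |Q r| < |τ| ^ (2 * m) := by
  have ha : 0 < |τ| ^ (2 * m) := Real.rpow_pos_of_pos (abs_pos.2 hτ) _
  rw [mwhRatio, abs_lt, div_pos_iff]
  constructor
  · rintro (h | h) <;> constructor <;> linarith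
  · rintro ⟨h1, h2⟩
    left; constructor <;> linarith

end Models

/-! ### State variables in terms of `s` -/

section StateEquations

variable {m τ s : ℝ}

/-- `ρ + p = 2 m s/τ²`, and once `s > 0` the bound `p ≤ ρ` is automatic because `p < 0 < ρ`. -/
theorem energyConditions_iff (hm : 0 < m) (hτ : τ ≠ 0) :
    EnergyConditions (m ^ 2 / τ ^ 2 * (1 + 2 / m * s)) (-(m ^ 2 / τ ^ 2)) ↔ 0 < s := by
  have hc : 0 < m ^ 2 / τ ^ 2 := by positivity
  have e : m ^ 2 / τ ^ 2 * (1 + 2 / m * s) = m ^ 2 / τ ^ 2 + m ^ 2 / τ ^ 2 * (2 / m) * s := by ring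
  have hc' : 0 < m ^ 2 / τ ^ 2 * (2 / m) := by positivity
  rw [EnergyConditions, e]
  constructor
  · rintro ⟨h, -⟩
    exact pos_of_mul_pos_right (by linarith) hc'.le
  · intro h
    have := mul_pos hc' h
    constructor <;> linarith

/-- The ratio `ṗ / ρ̇` of the proper time derivatives of the pressure and the energy density. -/
theorem indicatrix_eq (hm : 0 < m) (hτ : τ ≠ 0) :
    2 * m ^ 2 / τ ^ 3 / (-(2 * m / τ ^ 3 * (s * (2 + m * s)))) = -m / (s * (2 + m * s)) := by
  by_cases h : s * (2 + m * s) = 0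
  -- Where `u(ρ)` vanishes both quotients are `0` by the convention for division by zero.
  · simp [h]
  · have h1 := left_ne_zero_of_mul h
    have h2 := right_ne_zero_of_mul h
    field_simp

theorem pressure_div_density (hm : 0 < m) (hτ : τ ≠ 0) (hρ : m + 2 * s ≠ 0) :
    -(m ^ 2 / τ ^ 2) / (m ^ 2 / τ ^ 2 * (1 + 2 / m * s)) = -m / (m + 2 * s) := by
  have : 1 + 2 / m * s = (m + 2 * s) / m := by field_simp
  rw [this]
  field_simp

/-- With `π = -m/(m + 2 s)` one has `π + 1 = 2 s/(m + 2 s)` and `(4 - m²) π - m² = -2 m (2 + m s)/(m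
+ 2 s)`; these contain the factors of `u(ρ)`. -/
theorem mwhChi_eq (hm : 0 < m) (hρ : m + 2 * s ≠ 0) (hs : s * (2 + m * s) ≠ 0) :
    (-m / (m + 2 * s) + 1) * ((4 - m ^ 2) * (-m / (m + 2 * s)) - m ^ 2) ≠ 0 ∧
      -m / (s * (2 + m * s)) = mwhChi m (-m / (m + 2 * s)) := by
  have h1 := left_ne_zero_of_mul hs
  have h2 := right_ne_zero_of_mul hs
  have e : (-m / (m + 2 * s) + 1) * ((4 - m ^ 2) * (-m / (m + 2 * s)) - m ^ 2)
      = -4 * m * (s * (2 + m * s)) / (m + 2 * s) ^ 2 := by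
    field_simp; ring
  refine ⟨?_, ?_⟩
  · rw [e]
    exact div_ne_zero (mul_ne_zero (by simp [hm.ne']) hs) (pow_ne_zero 2 hρ)
  · rw [mwhChi, e]
    have h3 : m + s * 2 ≠ 0 := by rwa [mul_comm s]
    field_simp

theorem indicatrix_neg (hm : 0 < m) (hs : 0 < s) : -m / (s * (2 + m * s)) < 0 :=
  div_neg_of_neg_of_pos (by linarith) (by positivity)

/-- Positivity forces `s (2 + m s) < 0`, and completing the square shows `s (2 + m s) ≥ -m` when `m
≥ 1`. -/
theorem one_le_indicatrix_of_pos (hm : 1 ≤ m) (h : 0 < -m / (s * (2 + m * s))) :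
    1 ≤ -m / (s * (2 + m * s)) := by
  have hm0 : 0 < m := by linarith
  have hd : s * (2 + m * s) < 0 := by
    by_contra hc
    exact absurd h (not_lt.2 (div_nonpos_of_nonpos_of_nonneg (by linarith) (not_lt.1 hc)))
  rw [le_div_iff_of_neg hd]
  have : 0 ≤ m * (m + s * (2 + m * s)) := by
    have e : m * (m + s * (2 + m * s)) = (m * s + 1) ^ 2 + (m ^ 2 - 1) := by ring
    rw [e]; nlinarith [sq_nonneg (m * s + 1)]
  linarith [nonneg_of_mul_nonneg_right this hm0]

end StateEquations

/-! ### Derivatives along the flow -/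

section Fluid

variable {k m : ℝ} {Q : ℝ → ℝ} {J : Set ℝ} {x : Coord}

/-- Lets formulas known only on the domain be differentiated along `u`. -/
theorem eventually_update_mem_mwhDomain (hx : x ∈ mwhDomain k m Q J) :
    ∀ᶠ t in 𝓝 (x 0), Function.update x 0 t ∈ mwhDomain k m Q J := by
  obtain ⟨h0, h1, hc, hω⟩ := hx
  have hcont : ContinuousAt (fun t => mwhOmega m Q t (x 1)) (x 0) :=
    ((hasDerivAt_abs_rpow m h0).continuousAt).add
      ((hasDerivAt_abs_rpow (-m) h0).continuousAt.mul_const _)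
  filter_upwards [isOpen_ne.mem_nhds h0, hcont.eventually_ne hω] with t ht htω
  exact ⟨by simpa using ht, by simpa using h1, by simpa [conf] using hc, by simpa using htω⟩

theorem along_pressure {p : Coord → ℝ} (hx : x ∈ mwhDomain k m Q J)
    (hp : ∀ y ∈ mwhDomain k m Q J, p y = -(m ^ 2 / y 0 ^ 2)) :
    along comoving p x = 2 * m ^ 2 / x 0 ^ 3 := by
  have h0 : x 0 ≠ 0 := hx.1
  have e : (fun t => p (Function.update x 0 t)) =ᶠ[𝓝 (x 0)] fun t => -(m ^ 2 / t ^ 2) := by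
    filter_upwards [eventually_update_mem_mwhDomain hx] with t ht
    simpa using hp _ ht
  rw [along_comoving, partialD, e.deriv_eq, (((hasDerivAt_const (x 0) (m ^ 2)).fun_div
    ((hasDerivAt_id' (x 0)).fun_pow 2) (pow_ne_zero 2 h0)).fun_neg).deriv]
  push_cast
  field_simp
  ring

/-- The Riccati equation eliminates `s'`; the terms free of `s` then cancel, leaving the factor `s`.
-/
theorem along_density (hm : m ≠ 0) {ρ : Coord → ℝ} (hx : x ∈ mwhDomain k m Q J)
    (hρ : ∀ y ∈ mwhDomain k m Q J,
      ρ y = m ^ 2 / y 0 ^ 2 * (1 + 2 / m * mwhRatio m Q (y 0) (y 1))) :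
    along comoving ρ x = -(2 * m / x 0 ^ 3
      * (mwhRatio m Q (x 0) (x 1) * (2 + m * mwhRatio m Q (x 0) (x 1)))) := by
  have h0 : x 0 ≠ 0 := hx.1
  have e : (fun t => ρ (Function.update x 0 t)) =ᶠ[𝓝 (x 0)]
      fun t => m ^ 2 / t ^ 2 * (1 + 2 / m * mwhRatio m Q t (x 1)) := by
    filter_upwards [eventually_update_mem_mwhDomain hx] with t ht
    simpa using hρ _ ht
  rw [along_comoving, partialD, e.deriv_eq, (((hasDerivAt_const (x 0) (m ^ 2)).fun_div
    ((hasDerivAt_id' (x 0)).fun_pow 2) (pow_ne_zero 2 h0)).fun_mul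
      (((hasDerivAt_mwhRatio h0 hx.2.2.2).const_mul (2 / m)).const_add 1)).deriv]
  push_cast
  field_simp
  ring

end Fluid

end TModels

end

/-! ### The main theorem -/

open TModels in
theorem mainTheorem6 (k f₀ m : ℝ) (hk : k = 0 ∨ k = 1 ∨ k = -1) (hf₀ : 0 < f₀)
    (hk₀ : 0 < 1 + k / f₀) (hm : m = Real.sqrt (1 + k / f₀)) :
    -- the metrics with `φ = f₀ τ²` that are perfect fluid solutions
    (∀ (I J : Set ℝ) (ω : ℝ → ℝ → ℝ), IsOpen I → IsPreconnected I → 0 ∉ I → IsOpen J →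
      ContDiffOn ℝ 2 (Function.uncurry ω) (I ×ˢ J) → (∀ τ ∈ I, ∀ r ∈ J, ω τ r ≠ 0) →
      ((∃ ρ p : TModels.Coord → ℝ,
          TModels.IsPerfectFluidSolution (TModels.tMetric k (fun τ => f₀ * τ ^ 2) ω)
            TModels.comoving ρ p {x | x 0 ∈ I ∧ x 1 ∈ J ∧ TModels.conf k x ≠ 0}) ↔
        ∃ Q₁ Q₂ : ℝ → ℝ, ∀ τ ∈ I, ∀ r ∈ J, ω τ r = |τ| ^ m * Q₁ r + |τ| ^ (-m) * Q₂ r)) ∧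
    -- `ω₁` and `ω₂` are independent
    (∀ (I : Set ℝ) (a b : ℝ), IsOpen I → I.Nonempty → 0 ∉ I →
      (∀ τ ∈ I, a * |τ| ^ m + b * |τ| ^ (-m) = 0) → a = 0 ∧ b = 0) ∧
    -- the models `ω = ω₁ + ω₂ Q(r)`
    (∀ (J : Set ℝ) (Q : ℝ → ℝ), IsOpen J → ContDiffOn ℝ 2 Q J →
      -- pressure and energy density
      (∀ ρ p : TModels.Coord → ℝ,
        TModels.IsPerfectFluidSolution (TModels.mwhMetric k f₀ m Q) TModels.comoving ρ p
            (TModels.mwhDomain k m Q J) ↔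
          ∀ x ∈ TModels.mwhDomain k m Q J,
            p x = -(m ^ 2 / x 0 ^ 2) ∧
            ρ x = m ^ 2 / x 0 ^ 2 *
              (1 + 2 / m * ((|x 0| ^ (2 * m) - Q (x 1)) / (|x 0| ^ (2 * m) + Q (x 1))))) ∧
      ∀ ρ p : TModels.Coord → ℝ,
        TModels.IsPerfectFluidSolution (TModels.mwhMetric k f₀ m Q) TModels.comoving ρ p
            (TModels.mwhDomain k m Q J) →
          (∀ x ∈ TModels.mwhDomain k m Q J,
            -- negative pressure
            p x < 0 ∧
            -- the energy conditions
            (TModels.EnergyConditions (ρ x) (p x) ↔ |Q (x 1)| < |x 0| ^ (2 * m)) ∧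
            -- the indicatrix
            (ρ x ≠ 0 → TModels.along TModels.comoving ρ x ≠ 0 →
              (p x / ρ x + 1) * ((4 - m ^ 2) * (p x / ρ x) - m ^ 2) ≠ 0 ∧
              TModels.indicatrix TModels.comoving ρ p x = TModels.mwhChi m (p x / ρ x)) ∧
            -- failure of the compressibility conditions
            (TModels.EnergyConditions (ρ x) (p x) →
              0 < ρ x ∧ TModels.along TModels.comoving ρ x ≠ 0 ∧
              (∀ χ : ℝ → ℝ → ℝ,
                χ (ρ x) (p x) = TModels.indicatrix TModels.comoving ρ p x →
                  ¬ TModels.CompressibilityConditions χ (ρ x) (p x)) ∧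
              ¬ TModels.IdealCompressibilityConditions (TModels.mwhChi m) (p x / ρ x)) ∧
            (k ≠ -1 → TModels.along TModels.comoving ρ x ≠ 0 →
              ∀ χ : ℝ → ℝ → ℝ,
                χ (ρ x) (p x) = TModels.indicatrix TModels.comoving ρ p x →
                  ¬ TModels.CompressibilityConditions χ (ρ x) (p x))) ∧
          -- no region admits an interpretation as a perfect fluid in l.t.e.
          ∀ U : Set TModels.Coord, U ⊆ TModels.mwhDomain k m Q J → U.Nonempty →
            ¬ TModels.IsAdmissibleOn TModels.comoving ρ p U) := by

  have hm0 : 0 < m := hm ▸ Real.sqrt_pos.2 hk₀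
  have hm2 : m ^ 2 = 1 + k / f₀ := by rw [hm, Real.sq_sqrt hk₀.le]
  refine ⟨fun I J ω hI hIc h0 hJ hd hω =>
      exists_perfectFluid_iff hf₀.ne' hm0.ne' hm2 hI hIc h0 hJ hd hω,
    fun I a b hI hne h0 h => abs_rpow_linearIndependent hm0.ne' hI hne h0 h,
    fun J Q hJ hQ => ⟨mwh_isPerfectFluidSolution_iff hf₀.ne' hm0.ne' hm2 hJ hQ,
      fun ρ p hfluid => ?_⟩⟩
  have hsol := (mwh_isPerfectFluidSolution_iff hf₀.ne' hm0.ne' hm2 hJ hQ ρ p).1 hfluid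
  have hind : ∀ x ∈ mwhDomain k m Q J, along comoving p x / along comoving ρ x
      = -m / (mwhRatio m Q (x 0) (x 1) * (2 + m * mwhRatio m Q (x 0) (x 1))) := fun x hx => by
    rw [along_pressure hx fun y hy => (hsol y hy).1,
      along_density hm0.ne' hx fun y hy => (hsol y hy).2, indicatrix_eq hm0 hx.1]
  have hpos : ∀ x ∈ mwhDomain k m Q J, EnergyConditions (ρ x) (p x) →
      0 < mwhRatio m Q (x 0) (x 1) := fun x hx h => by
    rwa [(hsol x hx).1, (hsol x hx).2, energyConditions_iff hm0 hx.1] at h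
  have hne : ∀ x ∈ mwhDomain k m Q J, EnergyConditions (ρ x) (p x) →
      along comoving ρ x ≠ 0 := fun x hx h => by
    have h0 : x 0 ≠ 0 := hx.1
    have hs := hpos x hx h
    rw [along_density hm0.ne' hx fun y hy => (hsol y hy).2, neg_ne_zero]
    positivity
  have hneg : ∀ x ∈ mwhDomain k m Q J, EnergyConditions (ρ x) (p x) →
      along comoving p x / along comoving ρ x < 0 := fun x hx h =>
    hind x hx ▸ indicatrix_neg hm0 (hpos x hx h)
  refine ⟨fun x hx => ?_, fun U hU hUne hadm => ?_⟩
  · have h0 : x 0 ≠ 0 := hx.1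
    have hp := (hsol x hx).1
    have hρ := (hsol x hx).2
    have hchi : ρ x ≠ 0 → along comoving ρ x ≠ 0 →
        (p x / ρ x + 1) * ((4 - m ^ 2) * (p x / ρ x) - m ^ 2) ≠ 0 ∧
          indicatrix comoving ρ p x = mwhChi m (p x / ρ x) := by
      intro hρ0 hρd
      have hd : m + 2 * mwhRatio m Q (x 0) (x 1) ≠ 0 := by
        -- `ρ = (m/τ²)(m + 2 s)`, so `m + 2 s = 0` would make the density vanish.
        intro h
        apply hρ0
        rw [hρ]
        field_simp
        simp [h]
      rw [along_density hm0.ne' hx fun y hy => (hsol y hy).2] at hρd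
      have hs := right_ne_zero_of_mul (neg_ne_zero.1 hρd)
      rw [indicatrix, hind x hx, hp, hρ, pressure_div_density hm0 h0 hd]
      exact mwhChi_eq hm0 hd hs
    have hρpos : EnergyConditions (ρ x) (p x) → 0 < ρ x := fun h => by
      have hs := hpos x hx h
      rw [hρ]
      positivity
    refine ⟨?_, ?_, hchi, fun h => ⟨hρpos h, hne x hx h, fun χ hχ hH => ?_, fun hH => ?_⟩,
      fun hk1 hρd χ hχ hH => ?_⟩
    · rw [hp]
      exact neg_neg_of_pos (by positivity)
    · rw [hp, hρ, energyConditions_iff hm0 h0, mwhRatio_pos_iff h0]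
    · exact lt_asymm (hneg x hx h) ((hχ ▸ hH.1 : 0 < indicatrix comoving ρ p x))
    · have e := (hchi (hρpos h).ne' (hne x hx h)).2
      exact lt_asymm (hneg x hx h) ((e ▸ hH.1 : 0 < indicatrix comoving ρ p x))
    -- Excluding `k = -1` leaves `k ≥ 0`, hence `m² = 1 + k/f₀ ≥ 1`.
    · have hk0 : 0 ≤ k := by rcases hk with h | h | h <;> simp_all
      have hm1 : 1 ≤ m := by
        rw [hm, Real.one_le_sqrt]
        linarith [div_nonneg hk0 hf₀.le]
      have h1 : 0 < indicatrix comoving ρ p x := hχ ▸ hH.1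
      have h2 : indicatrix comoving ρ p x < 1 := hχ ▸ hH.2.1
      rw [indicatrix, hind x hx] at h1 h2
      exact not_lt.2 (one_le_indicatrix_of_pos hm1 h1) h2
  · obtain ⟨x, hx⟩ := hUne
    obtain ⟨χ, h⟩ := hadm
    obtain ⟨hE, hson, hH⟩ := h x hx
    have hn := hneg x (hU hx) hE
    -- Since `u(ρ) ≠ 0`, the sonic condition identifies `χ` with the negative quotient `u(p)/u(ρ)`;
    -- a single event suffices.
    rw [hson, mul_div_cancel_right₀ _ (hne x (hU hx) hE)] at hn
    exact lt_asymm hn hH.1
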